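/- Consider binary estimation with a helper: let $0\le p_1,p_2\le 1/2$, let $S_1^n$ be i.i.d. $\mathrm{Bern}(p_1)$ and $S_2^n$ i.i.d. $\mathrm{Bern}(p_2)$, independent of each other. For each block length $n$ a code consists of an encoder $f:\{0,1\}^n\to\{0,1\}^n$, producing $X^n=f(S_2^n)$ from the whole (noncausally known) interference word $S_2^n$, and a decoder $g:\{0,1\}^n\to\{0,1\}^n$, producing $\hat S_1^n=g(Y^n)$ from the channel output $Y^n=X^n\oplus S_1^n\oplus S_2^n$. It is an $(n,C)$ code if $\frac1n\,\mathbb E\sum_{i=1}^n \mathbf 1\{X_i=1\}\le C$, and its expected distortion is $\frac1n\,\mathbb E\sum_{i=1}^n \mathbf 1\{S_{1i}\ne\hat S_{1i}\}$. A distortion $D\in\mathbb R$ is achievable under the cost constraint $C$ if there are a sequence $\varepsilon_n\to0$ and $(n,C+\varepsilon_n)$ codes, $n\ge 1$, whose expected distortions have $\limsup_{n\to\infty}$ at most $D$; and $D(C)_{\min}$ is the infimum of all achievable distortions under the cost constraint $C$ (equal to $+\infty$ if there are none). (i) Let $0\le C\le 1$, let $X\sim\mathrm{Bern}(C)$, $S_1\sim\mathrm{Bern}(p_1)$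 and $S_2\sim\mathrm{Bern}(p_2)$ be independent, let $Y=X\oplus S_1\oplus S_2$, and let $H_2$ be the binary entropy function. If $H_2(C)>H(X\oplus S_2\mid Y)$, then $D(C)_{\min}=0$. (ii) If $C>p_1$, then $D(C)_{\min}=0$ (in particular also when $p_1<C<p_2$). -/

import Mathlib

noncomputable section

namespace HelperEstimation

/-- The binary alphabet `{0,1}`; addition in `ZMod 2` is addition modulo two (`⊕`). -/
abbrev Bit : Type := ZMod 2

/-- Binary words of length `n`. -/
abbrev Word (n : ℕ) : Type := Fin n → Bit

/-- Probability mass function of `Bern(p)`: the symbol `1` has probability `p`. -/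
def bern (p : ℝ) (b : Bit) : ℝ := if b = 1 then p else 1 - p

/-- Probability mass function of `n` i.i.d. `Bern(p)` symbols. -/
def bernWord (p : ℝ) (n : ℕ) (s : Word n) : ℝ := ∏ i, bern p (s i)

/-! ### Finite probability and conditional entropy -/

/-- Expectation of `F` under the probability mass function `P` on a finite sample space. -/
def expect {Ω : Type*} [Fintype Ω] (P : Ω → ℝ) (F : Ω → ℝ) : ℝ := ∑ ω, P ω * F ω

/-- Probability mass function of the random variable `A` under `P`. -/
def law {Ω α : Type*} [Fintype Ω] [DecidableEq α] (P : Ω → ℝ) (A : Ω → α) (a : α) : ℝ :=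
  ∑ ω with A ω = a, P ω

/-- Conditional Shannon entropy `H(A|B) = -∑ p(a,b) log p(a|b)`, in nats. Terms with `p(a,b) = 0`
vanish, as usual. -/
def condEntropy {Ω α β : Type*} [Fintype Ω] [Fintype α] [Fintype β] [DecidableEq α]
    [DecidableEq β] (P : Ω → ℝ) (A : Ω → α) (B : Ω → β) : ℝ :=
  -∑ b, ∑ a, law P (fun ω => (A ω, B ω)) (a, b) *
    Real.log (law P (fun ω => (A ω, B ω)) (a, b) / law P B b)

/-- Joint law of independent `X ∼ Bern(C)`, `S₁ ∼ Bern(p₁)`, `S₂ ∼ Bern(p₂)`; a sample is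
`(x, s₁, s₂)`. -/
def tripleLaw (p₁ p₂ C : ℝ) (ω : Bit × Bit × Bit) : ℝ :=
  bern C ω.1 * bern p₁ ω.2.1 * bern p₂ ω.2.2

/-- `H(X ⊕ S₂ | Y)` where `X ∼ Bern(C)`, `S₁`, `S₂` are independent and `Y = X ⊕ S₁ ⊕ S₂`. -/
def entropyXS₂GivenY (p₁ p₂ C : ℝ) : ℝ :=
  condEntropy (tripleLaw p₁ p₂ C)
    (fun ω => ω.1 + ω.2.2) (fun ω => ω.1 + ω.2.1 + ω.2.2)

/-! ### Codes for binary estimation with a helper -/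

/-- Per-letter cost: `1` for the symbol `1` and `0` for the symbol `0`. -/
def cost (x : Bit) : ℝ := if x = 1 then 1 else 0

/-- Per-letter Hamming distortion. -/
def distortion (s t : Bit) : ℝ := if s = t then 0 else 1

/-- The encoder (which sees the whole interference word `S₂ⁿ`) and the decoder (which sees `Yⁿ`)
of a block code of length `n`. -/
structure Code (n : ℕ) where
  /-- The encoder `S₂ⁿ ↦ Xⁿ`. -/
  enc : Word n → Word n
  /-- The decoder `Yⁿ ↦ Ŝ₁ⁿ`. -/
  dec : Word n → Word n

/-- Channel output `Yⁿ = Xⁿ ⊕ S₁ⁿ ⊕ S₂ⁿ` when the helper uses the code `c`. -/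
def Code.output {n : ℕ} (c : Code n) (s₁ s₂ : Word n) : Word n := c.enc s₂ + s₁ + s₂

/-- Expected per-symbol cost `E ∑ ρ(Xᵢ) / n`, where `S₂ⁿ` is i.i.d. `Bern(p₂)`. -/
def Code.expectedCost {n : ℕ} (c : Code n) (p₂ : ℝ) : ℝ :=
  expect (bernWord p₂ n) fun s₂ => (∑ i, cost (c.enc s₂ i)) / n

/-- Expected per-symbol distortion `E ∑ d(S₁ᵢ, Ŝ₁ᵢ) / n`, where `S₁ⁿ` and `S₂ⁿ` are independent,
i.i.d. `Bern(p₁)` and i.i.d. `Bern(p₂)` respectively. -/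
def Code.expectedDistortion {n : ℕ} (c : Code n) (p₁ p₂ : ℝ) : ℝ :=
  expect (fun s : Word n × Word n => bernWord p₁ n s.1 * bernWord p₂ n s.2) fun s =>
    (∑ i, distortion (s.1 i) (c.dec (c.output s.1 s.2) i)) / n

/-- `D` is achievable under the cost constraint `C`: there are `(n, C + εₙ)` codes with `εₙ → 0`
whose expected distortions have limit superior at most `D`. (Expected distortions lie in `[0,1]`,
so this is the genuine limit superior.) -/
def Achievable (p₁ p₂ C D : ℝ) : Prop :=
  ∃ (c : ∀ n : ℕ, Code n) (ε : ℕ → ℝ),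
    Filter.Tendsto ε Filter.atTop (nhds 0) ∧
    (∀ n, 1 ≤ n → (c n).expectedCost p₂ ≤ C + ε n) ∧
    Filter.limsup (fun n => (c n).expectedDistortion p₁ p₂) Filter.atTop ≤ D

/-- The minimum achievable distortion `D(C)_min`: the infimum of the achievable distortions under
the cost constraint `C`. It is taken in the extended reals, so that it is `⊤`, not `0`, when
nothing is achievable. -/
def minDistortion (p₁ p₂ C : ℝ) : EReal :=
  sInf ((fun D : ℝ => (D : EReal)) '' {D : ℝ | Achievable p₁ p₂ C D})

end HelperEstimation

end

/-!
If the helper can afford `X = S₂` (`p₂ ≤ C`) it cancels the interference, and if `p₁ = 0` there is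
nothing to estimate. In the remaining cases the helper steers `U = X ⊕ S₂` into a random codebook
known to the decoder, which sees `Y = U ⊕ S₁`, finds the codeword `U`, and outputs `Y ⊕ U = S₁`.

The codewords are drawn i.i.d. `Bern(q)`. A codeword within the cost budget of the interference
word exists with high probability if the rate of the codebook exceeds `h(q) - h(C)`, and the
decoder finds it if the rate is below the mutual information `h(q * p₁) - h(p₁)` over the channel
(`*` being binary convolution). So distortion zero is achievable as soon as
`h(q) - h(C) < h(q * p₁) - h(p₁)` (`exists_code_of_exponents`).

* With `q = p₂ * C`, the law of `X ⊕ S₂`, this is the condition `H(X ⊕ S₂ | Y) < H₂(C)`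
  (`entropyXS₂GivenY_eq`).
* With `q = 1 / 2` it reads `h(p₁) < h(C)`, which follows from `p₁ < C < 1 / 2`. Uniform codewords
  are all typical, so that the law of `S₂` does not matter.

The error probability is bounded by `exists_code`. The choice of the codeword depends on the whole
codebook; the union bound over ordered pairs (a codeword that covers `s`, another one that is
plausible for the resulting output) avoids any conditioning. It costs the factor `M² β γ`, with `M`
codewords, covering probability `β` and confusion probability `γ`, and is sufficient because `M β`
grows only at a small exponential rate. Whether the channel output is typical depends on the
codeword; therefore the helper uses only codewords for which this is likely, and by Markov's
inequality these are most of them (`tendsto_not_covers`).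
-/

noncomputable section

namespace HelperEstimation

open Filter Topology

/-! ### Expectations on finite probability spaces -/

/-- A probability mass function on a finite type. -/
structure IsPmf {Ω : Type*} [Fintype Ω] (P : Ω → ℝ) : Prop where
  nonneg : ∀ ω, 0 ≤ P ω
  sum_eq_one : ∑ ω, P ω = 1

open Classical in
/-- The real-valued indicator of a proposition, so that `expect P fun ω => ind (E ω)` is the
probability of the event `E`. -/
def ind (E : Prop) : ℝ := if E then 1 else 0

lemma ind_of_true {E : Prop} (h : E) : ind E = 1 := if_pos h

lemma ind_of_false {E : Prop} (h : ¬E) : ind E = 0 := if_neg h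

lemma ind_nonneg (E : Prop) : 0 ≤ ind E := by
  unfold ind; split_ifs <;> norm_num

lemma ind_le_one (E : Prop) : ind E ≤ 1 := by
  unfold ind; split_ifs <;> norm_num

lemma ind_not (E : Prop) : ind (¬E) = 1 - ind E := by
  by_cases h : E <;> simp [ind, h]

section Expect

variable {Ω Ω' : Type*} [Fintype Ω] [Fintype Ω'] {P : Ω → ℝ}

lemma IsPmf.expect_mono (hP : IsPmf P) {F G : Ω → ℝ} (h : ∀ ω, F ω ≤ G ω) :
    expect P F ≤ expect P G :=
  Finset.sum_le_sum fun ω _ => mul_le_mul_of_nonneg_left (h ω) (hP.nonneg ω)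

lemma IsPmf.expect_const (hP : IsPmf P) (a : ℝ) : expect P (fun _ => a) = a := by
  simp [expect, ← Finset.sum_mul, hP.sum_eq_one]

lemma IsPmf.expect_nonneg (hP : IsPmf P) {F : Ω → ℝ} (h : ∀ ω, 0 ≤ F ω) : 0 ≤ expect P F :=
  Finset.sum_nonneg fun ω _ => mul_nonneg (hP.nonneg ω) (h ω)

lemma IsPmf.expect_le (hP : IsPmf P) {F : Ω → ℝ} {a : ℝ} (h : ∀ ω, F ω ≤ a) :
    expect P F ≤ a :=
  (hP.expect_mono h).trans_eq (hP.expect_const a)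

lemma expect_add (P F G : Ω → ℝ) :
    expect P (fun ω => F ω + G ω) = expect P F + expect P G := by
  simp [expect, mul_add, Finset.sum_add_distrib]

lemma expect_sub (P F G : Ω → ℝ) :
    expect P (fun ω => F ω - G ω) = expect P F - expect P G := by
  simp [expect, mul_sub, Finset.sum_sub_distrib]

lemma expect_const_mul (P F : Ω → ℝ) (a : ℝ) :
    expect P (fun ω => a * F ω) = a * expect P F := by
  simp only [expect, Finset.mul_sum]
  exact Finset.sum_congr rfl fun ω _ => by ring

lemma expect_finset_sum {κ : Type*} (s : Finset κ) (P : Ω → ℝ) (F : κ → Ω → ℝ) :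
    expect P (fun ω => ∑ k ∈ s, F k ω) = ∑ k ∈ s, expect P (F k) := by
  simp only [expect, Finset.mul_sum]
  exact Finset.sum_comm

lemma expect_comm (P : Ω → ℝ) (P' : Ω' → ℝ) (F : Ω → Ω' → ℝ) :
    expect P (fun ω => expect P' (F ω)) = expect P' (fun ω' => expect P fun ω => F ω ω') := by
  simp only [expect, Finset.mul_sum]
  rw [Finset.sum_comm]
  exact Finset.sum_congr rfl fun _ _ => Finset.sum_congr rfl fun _ _ => by ring

/-- Some sample does at least as well as the average. -/
lemma IsPmf.exists_le_of_expect_le (hP : IsPmf P) {F : Ω → ℝ} {a : ℝ} (h : expect P F ≤ a) :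
    ∃ ω, F ω ≤ a := by
  by_contra! hcon
  have h1 : 0 ≤ expect P (fun ω => F ω - a) :=
    hP.expect_nonneg fun ω => (sub_pos.2 (hcon ω)).le
  have h2 : expect P (fun ω => F ω - a) = 0 := by
    refine le_antisymm ?_ h1
    rw [expect_sub, hP.expect_const]
    linarith
  have h3 := (Finset.sum_eq_zero_iff_of_nonneg
    (fun ω _ => mul_nonneg (hP.nonneg ω) (sub_pos.2 (hcon ω)).le)).1 h2
  have h4 : ∑ ω, P ω = 0 := Finset.sum_eq_zero fun ω hω =>
    (mul_eq_zero.1 (h3 ω hω)).resolve_right (sub_pos.2 (hcon ω)).ne'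
  rw [hP.sum_eq_one] at h4
  exact one_ne_zero h4

lemma IsPmf.markov (hP : IsPmf P) {F : Ω → ℝ} (hF : ∀ ω, 0 ≤ F ω) {a : ℝ} (ha : 0 < a) :
    expect P (fun ω => ind (a ≤ F ω)) ≤ expect P F / a := by
  rw [le_div_iff₀ ha, mul_comm, ← expect_const_mul]
  refine hP.expect_mono fun ω => ?_
  by_cases h : a ≤ F ω
  · simpa [ind_of_true h] using h
  · simpa [ind_of_false h] using hF ω

end Expect

/-! ### Independent, identically distributed families -/

section Iid

variable {ι α : Type*} [Fintype ι] [Fintype α]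

/-- The law of a family of independent variables, indexed by `ι`, with common law `Q`. -/
def iid (Q : α → ℝ) (ι : Type*) [Fintype ι] (c : ι → α) : ℝ := ∏ i, Q (c i)

lemma sum_prod_eq_prod_sum [DecidableEq ι] (f : ι → α → ℝ) :
    ∑ c : ι → α, ∏ i, f i (c i) = ∏ i, ∑ a, f i a := by
  rw [Finset.prod_univ_sum, Fintype.piFinset_univ]

variable [DecidableEq ι] {Q : α → ℝ}

lemma IsPmf.iid (hQ : IsPmf Q) : IsPmf (iid Q ι) where
  nonneg c := Finset.prod_nonneg fun i _ => hQ.nonneg _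
  sum_eq_one := by
    simp only [HelperEstimation.iid]
    rw [sum_prod_eq_prod_sum (fun _ => Q)]
    simp [hQ.sum_eq_one]

lemma expect_iid_prod (Q : α → ℝ) (F : ι → α → ℝ) :
    expect (iid Q ι) (fun c => ∏ i, F i (c i)) = ∏ i, expect Q (F i) := by
  simp only [expect, iid, ← Finset.prod_mul_distrib]
  exact sum_prod_eq_prod_sum (fun i a => Q a * F i a)

lemma IsPmf.expect_iid_apply (hQ : IsPmf Q) (i : ι) (F : α → ℝ) :
    expect (HelperEstimation.iid Q ι) (fun c => F (c i)) = expect Q F := by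
  have h := expect_iid_prod Q (fun k a => if k = i then F a else (1 : ℝ))
  have h1 : ∀ c : ι → α, ∏ k, (if k = i then F (c k) else (1 : ℝ)) = F (c i) := by
    intro c; simp
  have h2 : ∏ k, expect Q (fun a => if k = i then F a else (1 : ℝ)) = expect Q F := by
    rw [Finset.prod_eq_single i]
    · simp
    · intro b _ hb; simp [hb, hQ.expect_const]
    · simp
  rw [h2] at h
  simpa only [h1] using h

lemma IsPmf.expect_iid_mul (hQ : IsPmf Q) {i j : ι} (hij : i ≠ j) (F G : α → ℝ) :
    expect (HelperEstimation.iid Q ι) (fun c => F (c i) * G (c j)) = expect Q F * expect Q G := by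
  have h := expect_iid_prod Q
    (fun k a => (if k = i then F a else (1 : ℝ)) * (if k = j then G a else (1 : ℝ)))
  have h1 : ∀ c : ι → α, ∏ k, ((if k = i then F (c k) else (1 : ℝ)) *
      (if k = j then G (c k) else (1 : ℝ))) = F (c i) * G (c j) := by
    intro c; rw [Finset.prod_mul_distrib]; simp
  have h2 : ∏ k, expect Q (fun a => (if k = i then F a else (1 : ℝ)) *
      (if k = j then G a else (1 : ℝ))) = expect Q F * expect Q G := by
    rw [← Finset.mul_prod_erase _ _ (Finset.mem_univ i),
      ← Finset.mul_prod_erase _ _ (Finset.mem_erase.2 ⟨hij.symm, Finset.mem_univ j⟩),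
      Finset.prod_eq_one]
    · simp [hij, hij.symm]
    · intro k hk
      simp only [Finset.mem_erase] at hk
      simp [hk.1, hk.2.1, hQ.expect_const]
  rw [h2] at h
  simpa only [h1] using h

/-- Two distinct members of an i.i.d. family are independent with law `Q`. -/
lemma IsPmf.expect_iid_pair (hQ : IsPmf Q) {i j : ι} (hij : i ≠ j) (F : α → α → ℝ) :
    expect (HelperEstimation.iid Q ι) (fun c => F (c i) (c j)) =
      expect Q (fun u => expect Q (F u)) := by
  classical
  have h : ∀ c : ι → α, F (c i) (c j) =
      ∑ u, (if c i = u then (1 : ℝ) else 0) * F u (c j) := by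
    intro c; simp
  simp only [h]
  rw [expect_finset_sum]
  have h2 : ∀ u, expect (HelperEstimation.iid Q ι)
      (fun c => (if c i = u then (1 : ℝ) else 0) * F u (c j)) = Q u * expect Q (F u) := by
    intro u
    rw [hQ.expect_iid_mul hij (fun a => if a = u then (1 : ℝ) else 0)]
    simp [expect]
  simp only [h2]
  rfl

/-- Chebyshev's inequality for the sum of `n` independent copies of a centred variable. -/
lemma IsPmf.chebyshev (hQ : IsPmf Q) {z : α → ℝ} (hz : expect Q z = 0) {n : ℕ} (hn : 0 < n)
    {δ : ℝ} (hδ : 0 < δ) :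
    expect (HelperEstimation.iid Q (Fin n)) (fun w => ind (n * δ < |∑ i, z (w i)|)) ≤
      expect Q (fun a => z a ^ 2) / δ ^ 2 / n := by
  have hn' : (0 : ℝ) < n := by exact_mod_cast hn
  have hvar : expect (HelperEstimation.iid Q (Fin n)) (fun w => (∑ i, z (w i)) ^ 2) =
      n * expect Q (fun a => z a ^ 2) := by
    simp only [sq (∑ i, _), Finset.sum_mul_sum]
    rw [expect_finset_sum]
    simp only [expect_finset_sum]
    have h : ∀ i j : Fin n, expect (HelperEstimation.iid Q (Fin n)) (fun w => z (w i) * z (w j)) =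
        if i = j then expect Q (fun a => z a ^ 2) else 0 := by
      intro i j
      by_cases hij : i = j
      · subst hij
        simp only [if_true, ← sq]
        exact hQ.expect_iid_apply i (fun a => z a ^ 2)
      · rw [if_neg hij, hQ.expect_iid_mul hij, hz, zero_mul]
    simp [h]
  calc expect (HelperEstimation.iid Q (Fin n)) (fun w => ind (n * δ < |∑ i, z (w i)|))
      ≤ expect (HelperEstimation.iid Q (Fin n))
          (fun w => ind ((n * δ) ^ 2 ≤ (∑ i, z (w i)) ^ 2)) := by
        refine hQ.iid.expect_mono fun w => ?_
        by_cases h : n * δ < |∑ i, z (w i)|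
        · have : (n * δ) ^ 2 ≤ (∑ i, z (w i)) ^ 2 := by
            rw [← sq_abs (∑ i, z (w i))]
            exact pow_le_pow_left₀ (by positivity) h.le 2
          rw [ind_of_true this]; exact ind_le_one _
        · rw [ind_of_false h]; exact ind_nonneg _
    _ ≤ expect (HelperEstimation.iid Q (Fin n)) (fun w => (∑ i, z (w i)) ^ 2) / (n * δ) ^ 2 :=
        hQ.iid.markov (fun w => sq_nonneg _) (by positivity)
    _ = _ := by rw [hvar]; field_simp

/-- The weak law of large numbers for `iid`. -/
lemma IsPmf.tendsto_deviation (hQ : IsPmf Q) {z : α → ℝ} (hz : expect Q z = 0)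
    {δ : ℝ} (hδ : 0 < δ) :
    Filter.Tendsto (fun n : ℕ => expect (HelperEstimation.iid Q (Fin n))
      (fun w => ind (n * δ < |∑ i, z (w i)|))) Filter.atTop (nhds 0) := by
  refine squeeze_zero' (Filter.Eventually.of_forall fun n =>
      hQ.iid.expect_nonneg fun w => ind_nonneg _)
    (Filter.eventually_atTop.2 ⟨1, fun n hn => hQ.chebyshev hz hn hδ⟩) ?_
  exact tendsto_const_div_atTop_nhds_zero_nat _

end Iid

/-! ### The random coding bound -/

lemma isPmf_bern {p : ℝ} (h0 : 0 ≤ p) (h1 : p ≤ 1) : IsPmf (bern p) where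
  nonneg b := by unfold bern; split_ifs <;> linarith
  sum_eq_one := by
    rw [show (Finset.univ : Finset Bit) = {0, 1} from rfl]
    simp [bern]

lemma isPmf_bernWord {p : ℝ} (h0 : 0 ≤ p) (h1 : p ≤ 1) (n : ℕ) : IsPmf (bernWord p n) :=
  (isPmf_bern h0 h1).iid

lemma cost_le_one (x : Bit) : cost x ≤ 1 := by unfold cost; split_ifs <;> norm_num

lemma distortion_nonneg (x y : Bit) : 0 ≤ distortion x y := by
  unfold distortion; split_ifs <;> norm_num

lemma distortion_le_one (x y : Bit) : distortion x y ≤ 1 := by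
  unfold distortion; split_ifs <;> norm_num

lemma sum_div_le_one {n : ℕ} {f : Fin n → ℝ} (h : ∀ i, f i ≤ 1) : (∑ i, f i) / n ≤ 1 := by
  rcases Nat.eq_zero_or_pos n with rfl | hn
  · simp
  · rw [div_le_one (by exact_mod_cast hn)]
    simpa using Finset.sum_le_card_nsmul Finset.univ f 1 fun i _ => h i

lemma word_add_self {n : ℕ} (w : Word n) : w + w = 0 := by
  funext i; exact CharTwo.add_self_eq_zero (w i)

lemma word_add_cancel {n : ℕ} (u s t : Word n) : u + s + t + s = u + t := by
  rw [show u + s + t + s = u + t + (s + s) by abel, word_add_self, add_zero]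

lemma Code.expectedDistortion_eq {n : ℕ} (c : Code n) (p₁ p₂ : ℝ) :
    c.expectedDistortion p₁ p₂ = expect (bernWord p₂ n) fun s => expect (bernWord p₁ n) fun t =>
      (∑ i, distortion (t i) (c.dec (c.output t s) i)) / n := by
  rw [expect_comm]
  simp only [Code.expectedDistortion, expect, Fintype.sum_prod_type, Finset.mul_sum, mul_assoc]

open Classical in
/-- The code built from a codebook `c`. The encoder picks a codeword `u` with `A s u` (if there is
one) and sends `u + s`, so that the decoder sees `u + s₁`; the decoder picks a codeword `v` with
`B y v` (if there is one) and outputs `y + v`. -/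
def codeOfBook {n M : ℕ} (A B : Word n → Word n → Prop) (c : Fin M → Word n) : Code n where
  enc s := if h : ∃ i, A s (c i) then c h.choose + s else 0
  dec y := if h : ∃ j, B y (c j) then y + c h.choose else 0

/-- The contribution of a codebook `c` to the error probability, for the interference word `s`:
`s` is atypical, or no codeword covers `s`, or a codeword covering `s` can be mistaken for another
one. The last probability is replaced by its union bound over ordered pairs of codewords. -/
def bookError {n M : ℕ} (p₁ : ℝ) (S : Word n → Prop) (A B : Word n → Word n → Prop)
    (c : Fin M → Word n) (s : Word n) : ℝ :=
  ind (¬S s) + ind (S s ∧ ∀ i, ¬A s (c i)) + expect (bernWord p₁ n) fun t =>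
    ∑ k ∈ (Finset.univ : Finset (Fin M)).offDiag,
      ind (A s (c k.1)) * ind (B (c k.1 + t) (c k.2))

section OneShot

variable {n M : ℕ} {p₁ p₂ : ℝ} {S : Word n → Prop} {A B : Word n → Word n → Prop}

lemma bookError_nonneg (h0 : 0 ≤ p₁) (h1 : p₁ ≤ 1) (c : Fin M → Word n) (s : Word n) :
    0 ≤ bookError p₁ S A B c s :=
  add_nonneg (add_nonneg (ind_nonneg _) (ind_nonneg _))
    ((isPmf_bernWord h0 h1 n).expect_nonneg fun _ =>
      Finset.sum_nonneg fun _ _ => mul_nonneg (ind_nonneg _) (ind_nonneg _))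

lemma one_le_bookError (h0 : 0 ≤ p₁) (h1 : p₁ ≤ 1) {c : Fin M → Word n} {s : Word n}
    (h : ¬(∃ i, A s (c i))) : 1 ≤ bookError p₁ S A B c s := by
  have h2 := (isPmf_bernWord h0 h1 n).expect_nonneg (F := fun t =>
    ∑ k ∈ (Finset.univ : Finset (Fin M)).offDiag,
      ind (A s (c k.1)) * ind (B (c k.1 + t) (c k.2))) fun _ =>
      Finset.sum_nonneg fun _ _ => mul_nonneg (ind_nonneg _) (ind_nonneg _)
  unfold bookError
  by_cases hs : S s
  · have h3 := ind_of_true (E := S s ∧ ∀ i, ¬A s (c i)) ⟨hs, not_exists.1 h⟩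
    have h4 := ind_nonneg (¬S s)
    linarith
  · have h3 := ind_of_true (E := ¬S s) hs
    have h4 := ind_nonneg (S s ∧ ∀ i, ¬A s (c i))
    linarith

lemma codeOfBook_cost_le (h0 : 0 ≤ p₁) (h1 : p₁ ≤ 1) {K : ℝ} (hK : 0 ≤ K)
    (hcost : ∀ s u, A s u → (∑ i, cost ((u + s) i)) / n ≤ K) (c : Fin M → Word n) (s : Word n) :
    (∑ i, cost ((codeOfBook A B c).enc s i)) / n ≤ K + bookError p₁ S A B c s := by
  have hb := bookError_nonneg (S := S) (A := A) (B := B) h0 h1 c s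
  by_cases h : ∃ i, A s (c i)
  · have := hcost s _ h.choose_spec
    simp only [codeOfBook, dif_pos h]
    linarith
  · have := one_le_bookError (S := S) (B := B) h0 h1 h
    exact (sum_div_le_one fun i => cost_le_one _).trans (by linarith)

lemma codeOfBook_distortion_le (h0 : 0 ≤ p₁) (h1 : p₁ ≤ 1) {η : ℝ} (hη0 : 0 ≤ η)
    (hη : ∀ s u, A s u → expect (bernWord p₁ n) (fun t => ind (¬B (u + t) u)) ≤ η)
    (c : Fin M → Word n) (s : Word n) :
    (expect (bernWord p₁ n) fun t => (∑ i, distortion (t i)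
      ((codeOfBook A B c).dec ((codeOfBook A B c).output t s) i)) / n) ≤
      η + bookError p₁ S A B c s := by
  have hP := isPmf_bernWord h0 h1 n
  by_cases h : ∃ i, A s (c i)
  · set i := h.choose with hi
    have hA : A s (c i) := h.choose_spec
    have hout : ∀ t, (codeOfBook A B c).output t s = c i + t := by
      intro t
      simp only [Code.output, codeOfBook, dif_pos h, ← hi]
      exact word_add_cancel _ _ _
    simp only [hout]
    have hpt : ∀ t, (∑ k, distortion (t k) ((codeOfBook A B c).dec (c i + t) k)) / n ≤
        ind (¬B (c i + t) (c i)) + ∑ k ∈ (Finset.univ : Finset (Fin M)).offDiag,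
          ind (A s (c k.1)) * ind (B (c k.1 + t) (c k.2)) := by
      intro t
      have hsum0 : ∀ k ∈ (Finset.univ : Finset (Fin M)).offDiag,
          0 ≤ ind (A s (c k.1)) * ind (B (c k.1 + t) (c k.2)) :=
        fun _ _ => mul_nonneg (ind_nonneg _) (ind_nonneg _)
      have hle : (∑ k, distortion (t k) ((codeOfBook A B c).dec (c i + t) k)) / n ≤ 1 :=
        sum_div_le_one fun k => distortion_le_one _ _
      by_cases hB : B (c i + t) (c i)
      · have hex : ∃ j, B (c i + t) (c j) := ⟨i, hB⟩
        by_cases hj : hex.choose = i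
        · -- The decoder finds the codeword that was used.
          have hdec : (codeOfBook A B c).dec (c i + t) = t := by
            simp only [codeOfBook, dif_pos hex, hj]
            rw [show c i + t + c i = t + (c i + c i) by abel, word_add_self, add_zero]
          rw [hdec]
          have : (∑ k, distortion (t k) (t k)) / (n : ℝ) = 0 := by simp [distortion]
          rw [this]
          exact add_nonneg (ind_nonneg _) (Finset.sum_nonneg hsum0)
        · have hmem : (i, hex.choose) ∈ (Finset.univ : Finset (Fin M)).offDiag := by
            simpa [Finset.mem_offDiag] using fun h' => hj h'.symm
          have := Finset.single_le_sum hsum0 hmem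
          simp only [ind_of_true hA, ind_of_true hex.choose_spec, mul_one] at this
          have := ind_nonneg (¬B (c i + t) (c i))
          linarith
      · have := Finset.sum_nonneg hsum0
        rw [ind_of_true hB]
        linarith
    have h2 := hP.expect_mono hpt
    rw [expect_add] at h2
    have h3 := hη s _ hA
    have h4 := ind_nonneg (¬S s)
    have h5 := ind_nonneg (S s ∧ ∀ i, ¬A s (c i))
    unfold bookError
    linarith
  · have := one_le_bookError (S := S) (B := B) h0 h1 h
    exact (hP.expect_le fun t => sum_div_le_one fun k => distortion_le_one _ _).trans
      (by linarith)

lemma expect_uncovered_le {Q : Word n → ℝ} (hQ : IsPmf Q) {α : ℝ} {s : Word n}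
    (hα : α ≤ expect Q (fun u => ind (A s u))) :
    expect (iid Q (Fin M)) (fun c => ind (∀ i, ¬A s (c i))) ≤ Real.exp (-(α * M)) := by
  have h1 : ∀ c : Fin M → Word n, ind (∀ i, ¬A s (c i)) = ∏ i, ind (¬A s (c i)) := by
    intro c
    by_cases h : ∀ i, ¬A s (c i)
    · rw [ind_of_true h, Finset.prod_eq_one fun i _ => ind_of_true (h i)]
    · rw [ind_of_false h]
      obtain ⟨i, hi⟩ := not_forall.1 h
      exact (Finset.prod_eq_zero (Finset.mem_univ i) (ind_of_false hi)).symm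
  simp only [h1]
  rw [expect_iid_prod Q (fun _ u => ind (¬A s u))]
  have h2 : expect Q (fun u => ind (¬A s u)) = 1 - expect Q (fun u => ind (A s u)) := by
    simp only [ind_not]
    rw [expect_sub, hQ.expect_const]
  have h3 : 0 ≤ expect Q (fun u => ind (¬A s u)) := hQ.expect_nonneg fun u => ind_nonneg _
  have h4 : expect Q (fun u => ind (¬A s u)) ≤ Real.exp (-α) := by
    have := Real.add_one_le_exp (-α)
    linarith
  calc ∏ _i : Fin M, expect Q (fun u => ind (¬A s u))
      = expect Q (fun u => ind (¬A s u)) ^ M := by simp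
    _ ≤ Real.exp (-α) ^ M := pow_le_pow_left₀ h3 h4 M
    _ = _ := by rw [← Real.exp_nat_mul]; ring_nf

lemma expect_confusion_le {Q : Word n → ℝ} (hQ : IsPmf Q) {β γ : ℝ} (hγ0 : 0 ≤ γ)
    (hβ : ∀ s, expect Q (fun u => ind (A s u)) ≤ β)
    (hγ : ∀ y, expect Q (fun u => ind (B y u)) ≤ γ) (s t : Word n) :
    expect (iid Q (Fin M)) (fun c => ∑ k ∈ (Finset.univ : Finset (Fin M)).offDiag,
      ind (A s (c k.1)) * ind (B (c k.1 + t) (c k.2))) ≤ (M : ℝ) ^ 2 * β * γ := by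
  have hβ0 : 0 ≤ β := (hQ.expect_nonneg fun u => ind_nonneg _).trans (hβ s)
  rw [expect_finset_sum]
  have hk : ∀ k ∈ (Finset.univ : Finset (Fin M)).offDiag, expect (iid Q (Fin M))
      (fun c => ind (A s (c k.1)) * ind (B (c k.1 + t) (c k.2))) ≤ β * γ := by
    intro k hk
    rw [hQ.expect_iid_pair (Finset.mem_offDiag.1 hk).2.2
      (fun u v => ind (A s u) * ind (B (u + t) v))]
    simp only [expect_const_mul]
    calc expect Q (fun u => ind (A s u) * expect Q fun v => ind (B (u + t) v))
        ≤ expect Q (fun u => γ * ind (A s u)) := hQ.expect_mono fun u => by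
          rw [mul_comm γ]
          exact mul_le_mul_of_nonneg_left (hγ _) (ind_nonneg _)
      _ = γ * expect Q (fun u => ind (A s u)) := expect_const_mul _ _ _
      _ ≤ β * γ := by rw [mul_comm β]; exact mul_le_mul_of_nonneg_left (hβ s) hγ0
  refine (Finset.sum_le_card_nsmul _ _ _ hk).trans ?_
  rw [nsmul_eq_mul, mul_assoc]
  refine mul_le_mul_of_nonneg_right ?_ (mul_nonneg hβ0 hγ0)
  have : (Finset.univ : Finset (Fin M)).offDiag.card ≤ M ^ 2 := by
    rw [Finset.offDiag_card]; simp [sq]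
  exact_mod_cast this

lemma expect_bookError_le (h0 : 0 ≤ p₁) (h1 : p₁ ≤ 1) {Q : Word n → ℝ} (hQ : IsPmf Q)
    {α β γ : ℝ} (hγ0 : 0 ≤ γ)
    (hα : ∀ s, S s → α ≤ expect Q (fun u => ind (A s u)))
    (hβ : ∀ s, expect Q (fun u => ind (A s u)) ≤ β)
    (hγ : ∀ y, expect Q (fun u => ind (B y u)) ≤ γ) (s : Word n) :
    expect (iid Q (Fin M)) (fun c => bookError p₁ S A B c s) ≤
      ind (¬S s) + Real.exp (-(α * M)) + (M : ℝ) ^ 2 * β * γ := by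
  unfold bookError
  rw [expect_add, expect_add, hQ.iid.expect_const, expect_comm]
  gcongr
  · by_cases hs : S s
    · simpa only [hs, true_and] using expect_uncovered_le hQ (hα s hs)
    · simp only [hs, false_and, ind_of_false not_false, hQ.iid.expect_const]
      positivity
  · exact (isPmf_bernWord h0 h1 n).expect_le fun t => expect_confusion_le hQ hγ0 hβ hγ s t

/-- The one-shot random coding bound. The codewords are drawn independently with law `Q`; `A s u`
says that `u` is a suitable codeword for the interference `s`, and `B y u` that `u` is a plausible
codeword for the channel output `y`. -/
theorem exists_code (h0 : 0 ≤ p₁) (h1 : p₁ ≤ 1) (h0' : 0 ≤ p₂) (h1' : p₂ ≤ 1)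
    {Q : Word n → ℝ} (hQ : IsPmf Q) (M : ℕ) {α β γ η K : ℝ} (hγ0 : 0 ≤ γ) (hη0 : 0 ≤ η)
    (hK : 0 ≤ K)
    (hα : ∀ s, S s → α ≤ expect Q (fun u => ind (A s u)))
    (hβ : ∀ s, expect Q (fun u => ind (A s u)) ≤ β)
    (hγ : ∀ y, expect Q (fun u => ind (B y u)) ≤ γ)
    (hη : ∀ s u, A s u → expect (bernWord p₁ n) (fun t => ind (¬B (u + t) u)) ≤ η)
    (hcost : ∀ s u, A s u → (∑ i, cost ((u + s) i)) / n ≤ K) :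
    ∃ c : Code n,
      c.expectedCost p₂ ≤ K + (expect (bernWord p₂ n) (fun s => ind (¬S s)) +
        Real.exp (-(α * M)) + (M : ℝ) ^ 2 * β * γ) ∧
      c.expectedDistortion p₁ p₂ ≤ η + (expect (bernWord p₂ n) (fun s => ind (¬S s)) +
        Real.exp (-(α * M)) + (M : ℝ) ^ 2 * β * γ) := by
  have hP := isPmf_bernWord h0' h1' n
  have havg : expect (iid Q (Fin M))
      (fun c => expect (bernWord p₂ n) fun s => bookError p₁ S A B c s) ≤
      expect (bernWord p₂ n) (fun s => ind (¬S s)) +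
        Real.exp (-(α * M)) + (M : ℝ) ^ 2 * β * γ := by
    rw [expect_comm]
    refine (hP.expect_mono fun s =>
      expect_bookError_le (M := M) h0 h1 hQ hγ0 hα hβ hγ s).trans_eq ?_
    rw [expect_add, expect_add, hP.expect_const, hP.expect_const]
  obtain ⟨c, hc⟩ := hQ.iid.exists_le_of_expect_le havg
  refine ⟨codeOfBook A B c, ?_, ?_⟩
  · refine (hP.expect_mono fun s =>
      codeOfBook_cost_le (S := S) (B := B) h0 h1 hK hcost c s).trans ?_
    rw [expect_add, hP.expect_const]
    linarith
  · rw [Code.expectedDistortion_eq]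
    refine (hP.expect_mono fun s =>
      codeOfBook_distortion_le (S := S) h0 h1 hη0 hη c s).trans ?_
    rw [expect_add, hP.expect_const]
    linarith

end OneShot

/-! ### Typical words -/

/-- Weak typicality: the normalized log-likelihood of `w` under `Bern(p)` is within `δ` of
`-Real.binEntropy p`. For `p = 1 / 2` every word is typical. -/
def Typical (p δ : ℝ) {n : ℕ} (w : Word n) : Prop :=
  |Real.log (bernWord p n w) + n * Real.binEntropy p| ≤ n * δ

section Typical

variable {p δ : ℝ} {n : ℕ} {w : Word n}

lemma bern_pos (h0 : 0 < p) (h1 : p < 1) (b : Bit) : 0 < bern p b := by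
  unfold bern; split_ifs <;> linarith

lemma bernWord_pos (h0 : 0 < p) (h1 : p < 1) (w : Word n) : 0 < bernWord p n w :=
  Finset.prod_pos fun i _ => bern_pos h0 h1 (w i)

lemma Typical.bernWord_le (h0 : 0 < p) (h1 : p < 1) (h : Typical p δ w) :
    bernWord p n w ≤ Real.exp (-(n * (Real.binEntropy p - δ))) := by
  rw [← Real.log_le_iff_le_exp (bernWord_pos h0 h1 w)]
  linarith [(abs_le.1 h).2]

lemma Typical.le_bernWord (h0 : 0 < p) (h1 : p < 1) (h : Typical p δ w) :
    Real.exp (-(n * (Real.binEntropy p + δ))) ≤ bernWord p n w := by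
  rw [← Real.le_log_iff_exp_le (bernWord_pos h0 h1 w)]
  linarith [(abs_le.1 h).1]

lemma typical_half (hδ : 0 ≤ δ) (w : Word n) : Typical (1 / 2) δ w := by
  have h1 : ∀ b : Bit, bern (1 / 2) b = 1 / 2 := by
    intro b; unfold bern; split_ifs <;> norm_num
  have h2 : Real.log (bernWord (1 / 2) n w) = -(n * Real.log 2) := by
    simp only [bernWord, h1]
    simp
  unfold Typical
  rw [h2, one_div, Real.binEntropy_two_inv, neg_add_cancel, abs_zero]
  positivity

lemma sum_bit (f : Bit → ℝ) : ∑ b, f b = f 0 + f 1 := Fin.sum_univ_two f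

@[simp] lemma bern_zero_bit (p : ℝ) : bern p 0 = 1 - p := by simp [bern]

@[simp] lemma bern_one_bit (p : ℝ) : bern p 1 = p := by simp [bern]

lemma tendsto_not_typical (h0 : 0 < p) (h1 : p < 1) (hδ : 0 < δ) :
    Tendsto (fun n : ℕ => expect (bernWord p n) fun w => ind (¬Typical p δ w)) atTop (𝓝 0) := by
  have hz : expect (bern p) (fun b => Real.log (bern p b) + Real.binEntropy p) = 0 := by
    simp only [expect, sum_bit, bern_zero_bit, bern_one_bit, Real.binEntropy, Real.log_inv]
    ring
  have h := (isPmf_bern h0.le h1.le).tendsto_deviation hz hδ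
  refine h.congr fun n => ?_
  refine congrArg _ (funext fun w => ?_)
  have hs : ∑ i, (Real.log (bern p (w i)) + Real.binEntropy p) =
      Real.log (bernWord p n w) + n * Real.binEntropy p := by
    rw [bernWord, Real.log_prod fun i _ => (bern_pos h0 h1 (w i)).ne', Finset.sum_add_distrib]
    simp
  rw [hs, Typical, not_le]

lemma tendsto_cost_exceeds (h0 : 0 ≤ p) (h1 : p ≤ 1) (hδ : 0 < δ) :
    Tendsto (fun n : ℕ => expect (bernWord p n) fun w =>
      ind (¬(∑ i, cost (w i)) / n ≤ p + δ)) atTop (𝓝 0) := by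
  have hz : expect (bern p) (fun b => cost b - p) = 0 := by
    simp only [expect, sum_bit, bern_zero_bit, bern_one_bit, cost]
    norm_num
    ring
  have hP := fun n => isPmf_bernWord h0 h1 n
  have h := (isPmf_bern h0 h1).tendsto_deviation hz hδ
  refine squeeze_zero' (Eventually.of_forall fun n => (hP n).expect_nonneg fun w => ind_nonneg _)
    ?_ h
  filter_upwards [eventually_gt_atTop 0] with n hn
  refine (hP n).expect_mono fun w => ?_
  by_cases hc : (∑ i, cost (w i)) / n ≤ p + δ
  · rw [ind_of_false (not_not.2 hc)]; exact ind_nonneg _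
  · have hn' : (0 : ℝ) < n := by exact_mod_cast hn
    have h2 : n * δ < |∑ i, (cost (w i) - p)| := by
      refine lt_of_lt_of_le ?_ (le_abs_self _)
      rw [not_le, lt_div_iff₀ hn'] at hc
      simp only [Finset.sum_sub_distrib, Finset.sum_const, Finset.card_univ, Fintype.card_fin,
        nsmul_eq_mul]
      linarith
    rw [ind_of_true h2]; exact ind_le_one _

end Typical

/-! ### Sums modulo two of Bernoulli words -/

/-- Binary convolution: the sum modulo two of independent `Bern(a)` and `Bern(b)` symbols is
`Bern(bconv a b)`. -/
def bconv (a b : ℝ) : ℝ := a * (1 - b) + (1 - a) * b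

lemma sum_bern_mul_bern_add (a b : ℝ) (y : Bit) :
    ∑ x, bern a x * bern b (y + x) = bern (bconv a b) y := by
  have h : y = 0 ∨ y = 1 := by revert y; decide
  have h11 : (1 : Bit) + 1 = 0 := rfl
  rcases h with rfl | rfl <;> simp [sum_bit, bconv, h11] <;> ring

lemma sum_bernWord_mul_bernWord_add (a b : ℝ) {n : ℕ} (y : Word n) :
    ∑ x, bernWord a n x * bernWord b n (y + x) = bernWord (bconv a b) n y := by
  simp only [bernWord, ← Finset.prod_mul_distrib, Pi.add_apply]
  rw [sum_prod_eq_prod_sum (fun i x => bern a x * bern b (y i + x))]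
  simp only [sum_bern_mul_bern_add]

lemma sum_add_left {n : ℕ} (s : Word n) (F : Word n → ℝ) : ∑ x, F (s + x) = ∑ u, F u :=
  Fintype.sum_equiv (Equiv.addLeft s) _ _ fun _ => rfl

lemma word_add_cancel_left {n : ℕ} (s x : Word n) : s + (s + x) = x := by
  rw [← add_assoc, word_add_self, zero_add]

lemma expect_bernWord_add (a b : ℝ) {n : ℕ} (F : Word n → ℝ) :
    expect (bernWord a n) (fun s => expect (bernWord b n) fun x => F (s + x)) =
      expect (bernWord (bconv a b) n) F := by
  have h : ∀ s : Word n, expect (bernWord b n) (fun x => F (s + x)) =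
      ∑ u, bernWord b n (u + s) * F u := by
    intro s
    rw [expect, ← sum_add_left s (fun u => bernWord b n (u + s) * F u)]
    refine Finset.sum_congr rfl fun x _ => ?_
    rw [add_comm (s + x) s, word_add_cancel_left]
  simp only [h]
  simp only [expect, Finset.mul_sum]
  rw [Finset.sum_comm]
  refine Finset.sum_congr rfl fun u _ => ?_
  rw [← sum_bernWord_mul_bernWord_add, Finset.sum_mul]
  exact Finset.sum_congr rfl fun x _ => by ring

lemma bconv_pos {a b : ℝ} (ha : 0 < a) (ha' : a < 1) (hb : 0 ≤ b) (hb' : b < 1) :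
    0 < bconv a b := by
  have := mul_pos ha (sub_pos.2 hb')
  have := mul_nonneg (sub_pos.2 ha').le hb
  unfold bconv; linarith

lemma bconv_lt_one {a b : ℝ} (ha : 0 < a) (ha' : a < 1) (hb : 0 ≤ b) (hb' : b < 1) :
    bconv a b < 1 := by
  have := mul_pos (sub_pos.2 ha') (sub_pos.2 hb')
  have := mul_nonneg ha.le hb
  unfold bconv; nlinarith

/-! ### Exponents of the covering and confusion probabilities -/

section Exponents

variable {n : ℕ} {C q p δ : ℝ}

lemma expect_eq_expect_add (Q : Word n → ℝ) (P : Word n → ℝ) (hP : ∀ x, P x ≠ 0) (s : Word n)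
    (F : Word n → ℝ) :
    expect Q F = expect P fun x => Q (s + x) / P x * F (s + x) := by
  rw [expect, ← sum_add_left s]
  refine Finset.sum_congr rfl fun x _ => ?_
  rw [← mul_assoc, mul_div_cancel₀ _ (hP x)]

/-- If `A` forces typicality, a codeword of law `Bern(q)` covers `s` with probability at least
`exp (-n (h(q) - h(C) + 2 δ))` times the `Bern(C)`-probability that `s + x` covers `s`. -/
lemma le_expect_cover (hC : 0 < C) (hC' : C < 1) (hq : 0 < q) (hq' : q < 1)
    {A : Word n → Prop} {s : Word n} (hA : ∀ u, A u → Typical C δ (u + s) ∧ Typical q δ u) :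
    Real.exp (-(n * (Real.binEntropy q - Real.binEntropy C + 2 * δ))) *
      expect (bernWord C n) (fun x => ind (A (s + x))) ≤
      expect (bernWord q n) (fun u => ind (A u)) := by
  rw [expect_eq_expect_add (bernWord q n) (bernWord C n) (fun x => (bernWord_pos hC hC' x).ne') s,
    ← expect_const_mul]
  refine (isPmf_bernWord hC.le hC'.le n).expect_mono fun x => ?_
  by_cases h : A (s + x)
  · obtain ⟨h1, h2⟩ := hA _ h
    rw [add_comm, word_add_cancel_left] at h1
    refine mul_le_mul_of_nonneg_right ?_ (ind_nonneg _)
    rw [le_div_iff₀ (bernWord_pos hC hC' x)]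
    refine (mul_le_mul_of_nonneg_left (h1.bernWord_le hC hC') (Real.exp_nonneg _)).trans ?_
    rw [← Real.exp_add]
    refine le_trans (Real.exp_le_exp.2 (le_of_eq ?_)) (h2.le_bernWord hq hq')
    ring
  · simp [ind_of_false h]

lemma expect_cover_le (hC : 0 < C) (hC' : C < 1) (hq : 0 < q) (hq' : q < 1)
    {A : Word n → Prop} {s : Word n} (hA : ∀ u, A u → Typical C δ (u + s) ∧ Typical q δ u) :
    expect (bernWord q n) (fun u => ind (A u)) ≤
      Real.exp (-(n * (Real.binEntropy q - Real.binEntropy C - 2 * δ))) := by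
  rw [expect_eq_expect_add (bernWord q n) (bernWord C n) (fun x => (bernWord_pos hC hC' x).ne') s]
  refine (isPmf_bernWord hC.le hC'.le n).expect_le fun x => ?_
  by_cases h : A (s + x)
  · obtain ⟨h1, h2⟩ := hA _ h
    rw [add_comm, word_add_cancel_left] at h1
    rw [ind_of_true h, mul_one, div_le_iff₀ (bernWord_pos hC hC' x)]
    refine (h2.bernWord_le hq hq').trans (le_trans (le_of_eq ?_)
      (mul_le_mul_of_nonneg_left (h1.le_bernWord hC hC') (Real.exp_nonneg _)))
    rw [← Real.exp_add]
    ring_nf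
  · rw [ind_of_false h, mul_zero]; positivity

/-- A codeword independent of the channel output `y` is plausible only with the probability
`exp (-n I)`, where `I = h(q * p) - h(p)` is the mutual information over the channel. -/
lemma expect_confuse_le (hp : 0 < p) (hp' : p < 1) (hq : 0 < q) (hq' : q < 1)
    {B : Word n → Prop} {y : Word n}
    (hB : ∀ u, B u → Typical p δ (y + u) ∧ Typical (bconv q p) δ y) :
    expect (bernWord q n) (fun u => ind (B u)) ≤
      Real.exp (-(n * (Real.binEntropy (bconv q p) - Real.binEntropy p - 2 * δ))) := by
  by_cases hy : Typical (bconv q p) δ y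
  · have hQ := isPmf_bernWord hq.le hq'.le n
    calc expect (bernWord q n) (fun u => ind (B u))
        ≤ expect (bernWord q n) (fun u => Real.exp (n * (Real.binEntropy p + δ)) *
            bernWord p n (y + u)) := by
          refine hQ.expect_mono fun u => ?_
          by_cases h : B u
          · rw [ind_of_true h]
            have h1 := mul_le_mul_of_nonneg_left ((hB u h).1.le_bernWord hp hp')
              (Real.exp_nonneg (n * (Real.binEntropy p + δ)))
            rwa [← Real.exp_add, add_neg_cancel, Real.exp_zero] at h1
          · rw [ind_of_false h]
            exact mul_nonneg (Real.exp_nonneg _) (bernWord_pos hp hp' _).le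
      _ = Real.exp (n * (Real.binEntropy p + δ)) * bernWord (bconv q p) n y := by
          rw [expect_const_mul, expect, sum_bernWord_mul_bernWord_add]
      _ ≤ Real.exp (n * (Real.binEntropy p + δ)) *
            Real.exp (-(n * (Real.binEntropy (bconv q p) - δ))) :=
          mul_le_mul_of_nonneg_left (hy.bernWord_le (bconv_pos hq hq' hp.le hp')
            (bconv_lt_one hq hq' hp.le hp')) (Real.exp_nonneg _)
      _ = _ := by rw [← Real.exp_add]; ring_nf
  · have h : ∀ u, ind (B u) = 0 := fun u => ind_of_false fun hu => hy (hB u hu).2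
    simp only [h, expect, mul_zero, Finset.sum_const_zero]
    positivity

end Exponents

/-! ### Asymptotics of random coding -/

/-- The number of codewords of a random codebook: its rate exceeds the covering exponent `I`
by `3 δ`. -/
def bookSize (I δ : ℝ) (n : ℕ) : ℕ := ⌈Real.exp (n * (I + 3 * δ))⌉₊

section Asymptotics

variable {I δ : ℝ}

lemma exp_uncovered_le (n : ℕ) :
    Real.exp (-(1 / 2 * Real.exp (-(n * (I + 2 * δ))) * bookSize I δ n)) ≤
      Real.exp (-(1 / 2 * Real.exp (n * δ))) := by
  have h : Real.exp (n * (I + 3 * δ)) ≤ bookSize I δ n := Nat.le_ceil _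
  have h2 : Real.exp (n * δ) = Real.exp (-(n * (I + 2 * δ))) * Real.exp (n * (I + 3 * δ)) := by
    rw [← Real.exp_add]; ring_nf
  rw [Real.exp_le_exp, neg_le_neg_iff, h2, mul_assoc]
  gcongr

lemma confusion_le (hI : 0 ≤ I) (hδ : 0 ≤ δ) (J : ℝ) (hJ : J = I + 20 * δ) (n : ℕ) :
    (bookSize I δ n : ℝ) ^ 2 * Real.exp (-(n * (I - 2 * δ))) * Real.exp (-(n * (J - 2 * δ))) ≤
      4 * Real.exp (-(10 * (n * δ))) := by
  have h0 : 1 ≤ Real.exp (n * (I + 3 * δ)) := Real.one_le_exp (by positivity)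
  have h1 : (bookSize I δ n : ℝ) ≤ 2 * Real.exp (n * (I + 3 * δ)) := by
    have := (Nat.ceil_lt_add_one (Real.exp_nonneg (n * (I + 3 * δ)))).le
    unfold bookSize
    linarith
  calc (bookSize I δ n : ℝ) ^ 2 * Real.exp (-(n * (I - 2 * δ))) *
        Real.exp (-(n * (J - 2 * δ)))
      ≤ (2 * Real.exp (n * (I + 3 * δ))) ^ 2 * Real.exp (-(n * (I - 2 * δ))) *
        Real.exp (-(n * (J - 2 * δ))) := by gcongr
    _ = 4 * Real.exp (-(10 * (n * δ))) := by
      rw [mul_pow, ← Real.exp_nat_mul, mul_assoc, mul_assoc, ← Real.exp_add, ← Real.exp_add, hJ]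
      norm_num
      ring

lemma tendsto_rate_errors (hδ : 0 < δ) :
    Tendsto (fun n : ℕ => Real.exp (-(1 / 2 * Real.exp (n * δ))) +
      4 * Real.exp (-(10 * (n * δ)))) atTop (𝓝 0) := by
  have h1 : Tendsto (fun n : ℕ => (n : ℝ) * δ) atTop atTop :=
    tendsto_natCast_atTop_atTop.atTop_mul_const hδ
  have h2 := Real.tendsto_exp_neg_atTop_nhds_zero.comp
    ((Real.tendsto_exp_atTop.comp h1).const_mul_atTop (by norm_num : (0 : ℝ) < 1 / 2))
  have h3 := (Real.tendsto_exp_neg_atTop_nhds_zero.comp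
    (h1.const_mul_atTop (by norm_num : (0 : ℝ) < 10))).const_mul 4
  simpa using h2.add h3

end Asymptotics

/-- The codeword `u` is plausible for the channel output `y`: both the noise `y + u` that it would
explain and `y` itself are typical. -/
def Plausible (p₁ q δ : ℝ) {n : ℕ} (y u : Word n) : Prop :=
  Typical p₁ δ (y + u) ∧ Typical (bconv q p₁) δ y

/-- The helper may use the codeword `u` for the interference `s`, that is, send `u + s`. Besides
typicality and the cost bound this demands that the channel is unlikely to make `u` implausible. -/
def Covers (p₁ C q δ κ η : ℝ) {n : ℕ} (s u : Word n) : Prop :=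
  Typical C δ (u + s) ∧ (∑ i, cost ((u + s) i)) / n ≤ C + κ ∧ Typical q δ u ∧
    expect (bernWord p₁ n) (fun t => ind (¬Plausible p₁ q δ (u + t) u)) ≤ η

lemma ind_le_add_of_imp {E E₁ E₂ : Prop} (h : E → E₁ ∨ E₂) : ind E ≤ ind E₁ + ind E₂ := by
  by_cases hE : E
  · rcases h hE with h | h
    · rw [ind_of_true h]; linarith [ind_le_one E, ind_nonneg E₂]
    · rw [ind_of_true h]; linarith [ind_le_one E, ind_nonneg E₁]
  · rw [ind_of_false hE]; exact add_nonneg (ind_nonneg _) (ind_nonneg _)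

lemma ind_mono {E F : Prop} (h : E → F) : ind E ≤ ind F := by
  by_cases hE : E
  · rw [ind_of_true (h hE)]; exact ind_le_one _
  · rw [ind_of_false hE]; exact ind_nonneg _

section RandomCoding

variable {p₁ p₂ C q δ κ η : ℝ}

/-- If `x` is i.i.d. `Bern(C)`, then `s + x` covers `s` with high probability. -/
lemma tendsto_not_covers (hp₁ : 0 < p₁) (hp₁' : p₁ < 1) (hp₂ : 0 ≤ p₂) (hp₂' : p₂ ≤ 1)
    (hC : 0 < C) (hC' : C < 1) (hδ : 0 < δ) (hκ : 0 < κ) (hη : 0 < η)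
    (hU : Tendsto (fun n : ℕ => expect (bernWord p₂ n) fun s => expect (bernWord C n) fun x =>
      ind (¬Typical q δ (s + x))) atTop (𝓝 0))
    (hY : Tendsto (fun n : ℕ => expect (bernWord p₂ n) fun s => expect (bernWord C n) fun x =>
      expect (bernWord p₁ n) fun t => ind (¬Typical (bconv q p₁) δ (s + x + t))) atTop (𝓝 0)) :
    Tendsto (fun n : ℕ => expect (bernWord p₂ n) fun s => expect (bernWord C n) fun x =>
      ind (¬Covers p₁ C q δ κ η s (s + x))) atTop (𝓝 0) := by
  have P1 := fun n => isPmf_bernWord hp₁.le hp₁'.le n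
  have P2 := fun n => isPmf_bernWord hp₂ hp₂' n
  have PC := fun n => isPmf_bernWord hC.le hC'.le n
  have hlim := (((tendsto_not_typical hC hC' hδ).add (tendsto_cost_exceeds hC.le hC'.le hκ)).add
    hU).add (((tendsto_not_typical hp₁ hp₁' hδ).add hY).div_const η)
  simp only [add_zero, zero_div] at hlim
  refine squeeze_zero (fun n => (P2 n).expect_nonneg fun s => (PC n).expect_nonneg fun x =>
    ind_nonneg _) (fun n => ?_) hlim
  have himp : ∀ s x : Word n, ind (¬Covers p₁ C q δ κ η s (s + x)) ≤
      ind (¬Typical C δ x) + ind (¬(∑ i, cost (x i)) / n ≤ C + κ) + ind (¬Typical q δ (s + x)) +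
      ind (η ≤ expect (bernWord p₁ n) fun t => ind (¬Plausible p₁ q δ (s + x + t) (s + x))) := by
    intro s x
    have hx : s + x + s = x := by rw [add_comm, word_add_cancel_left]
    have h4 : ¬Covers p₁ C q δ κ η s (s + x) →
        ((¬Typical C δ x ∨ ¬(∑ i, cost (x i)) / n ≤ C + κ) ∨ ¬Typical q δ (s + x)) ∨
        η ≤ expect (bernWord p₁ n) fun t => ind (¬Plausible p₁ q δ (s + x + t) (s + x)) := by
      intro h
      by_contra! hcon
      refine h ⟨?_, ?_, hcon.1.2, hcon.2.le⟩
      · rw [hx]; exact hcon.1.1.1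
      · rw [hx]; exact hcon.1.1.2
    have h3 := ind_le_add_of_imp h4
    have h2 := ind_le_add_of_imp
      (id : (¬Typical C δ x ∨ ¬(∑ i, cost (x i)) / n ≤ C + κ) ∨ ¬Typical q δ (s + x) → _)
    have h1 := ind_le_add_of_imp
      (id : ¬Typical C δ x ∨ ¬(∑ i, cost (x i)) / n ≤ C + κ → _)
    linarith
  have hmarkov : ∀ s : Word n, (expect (bernWord C n) fun x =>
      ind (η ≤ expect (bernWord p₁ n) fun t => ind (¬Plausible p₁ q δ (s + x + t) (s + x)))) ≤
      η⁻¹ * ((expect (bernWord p₁ n) fun t => ind (¬Typical p₁ δ t)) +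
        expect (bernWord C n) fun x => expect (bernWord p₁ n) fun t =>
          ind (¬Typical (bconv q p₁) δ (s + x + t))) := by
    intro s
    refine ((PC n).markov (fun x => (P1 n).expect_nonneg fun t => ind_nonneg _) hη).trans ?_
    rw [div_eq_inv_mul]
    refine mul_le_mul_of_nonneg_left ?_ (by positivity)
    rw [← (PC n).expect_const (expect (bernWord p₁ n) fun t => ind (¬Typical p₁ δ t)),
      ← expect_add]
    refine (PC n).expect_mono fun x => ?_
    rw [← expect_add]
    refine (P1 n).expect_mono fun t => ind_le_add_of_imp fun h => ?_
    rw [Plausible, not_and_or] at h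
    have ht : s + x + t + (s + x) = t := by
      rw [add_comm (s + x) t, add_assoc, word_add_self, add_zero]
    rwa [ht] at h
  refine ((P2 n).expect_mono fun s => ((PC n).expect_mono (himp s)).trans_eq
    ((expect_add _ _ _).trans (congrArg₂ _ ((expect_add _ _ _).trans
      (congrArg₂ _ (expect_add _ _ _) rfl)) rfl))).trans ?_
  refine ((P2 n).expect_mono fun s => add_le_add_right (hmarkov s) _).trans_eq ?_
  rw [expect_add, expect_add, expect_const_mul, expect_add, expect_add,
    (P2 n).expect_const, (P2 n).expect_const, (P2 n).expect_const, div_eq_inv_mul]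

/-- Random coding with codewords of law `Bern(q)` succeeds if the covering exponent
`h(q) - h(C)` is less than the mutual information `h(q * p₁) - h(p₁)` over the channel, and if
`s + x` and `s + x + t` are typical with high probability, where `s`, `x` and `t` are independent
Bernoulli words of parameters `p₂`, `C` and `p₁`. -/
theorem exists_code_of_exponents (hp₁ : 0 < p₁) (hp₁' : p₁ < 1) (hp₂ : 0 ≤ p₂) (hp₂' : p₂ ≤ 1)
    (hC : 0 < C) (hC' : C < 1) (hq : 0 < q) (hq' : q < 1)
    (hCq : Real.binEntropy C ≤ Real.binEntropy q)
    (hI : Real.binEntropy q - Real.binEntropy C <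
      Real.binEntropy (bconv q p₁) - Real.binEntropy p₁)
    (hU : ∀ δ > 0, Tendsto (fun n : ℕ => expect (bernWord p₂ n) fun s =>
      expect (bernWord C n) fun x => ind (¬Typical q δ (s + x))) atTop (𝓝 0))
    (hY : ∀ δ > 0, Tendsto (fun n : ℕ => expect (bernWord p₂ n) fun s =>
      expect (bernWord C n) fun x => expect (bernWord p₁ n) fun t =>
        ind (¬Typical (bconv q p₁) δ (s + x + t))) atTop (𝓝 0))
    (hκ : 0 < κ) :
    ∀ᶠ n in atTop, ∃ c : Code n,
      c.expectedCost p₂ ≤ C + κ ∧ c.expectedDistortion p₁ p₂ ≤ κ := by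
  -- The losses in the exponents add up to `10 δ`, half of the available gap.
  obtain ⟨δ, hδ⟩ : ∃ δ, δ = ((Real.binEntropy (bconv q p₁) - Real.binEntropy p₁) -
      (Real.binEntropy q - Real.binEntropy C)) / 20 := ⟨_, rfl⟩
  have hδ0 : 0 < δ := by rw [hδ]; linarith
  have hκ2 : 0 < κ / 2 := by positivity
  have hcov := (tendsto_not_covers hp₁ hp₁' hp₂ hp₂' hC hC' hδ0 hκ2 hκ2 (hU δ hδ0)
    (hY δ hδ0)).const_mul 2
  have hlim := hcov.add (tendsto_rate_errors hδ0)
  simp only [mul_zero, add_zero] at hlim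
  filter_upwards [hlim.eventually_lt_const hκ2] with n hn
  have P2 := isPmf_bernWord hp₂ hp₂' n
  have PC := isPmf_bernWord hC.le hC'.le n
  have hA : ∀ s u : Word n, Covers p₁ C q δ (κ / 2) (κ / 2) s u →
      Typical C δ (u + s) ∧ Typical q δ u := fun s u h => ⟨h.1, h.2.2.1⟩
  obtain ⟨c, hc1, hc2⟩ := exists_code (n := n) hp₁.le hp₁'.le hp₂ hp₂'
    (S := fun s => 1 / 2 ≤ expect (bernWord C n) fun x =>
      ind (Covers p₁ C q δ (κ / 2) (κ / 2) s (s + x)))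
    (A := Covers p₁ C q δ (κ / 2) (κ / 2)) (B := Plausible p₁ q δ)
    (isPmf_bernWord hq.le hq'.le n)
    (bookSize (Real.binEntropy q - Real.binEntropy C) δ n)
    (α := 1 / 2 * Real.exp (-(n * (Real.binEntropy q - Real.binEntropy C + 2 * δ))))
    (β := Real.exp (-(n * (Real.binEntropy q - Real.binEntropy C - 2 * δ))))
    (γ := Real.exp (-(n * (Real.binEntropy (bconv q p₁) - Real.binEntropy p₁ - 2 * δ))))
    (η := κ / 2) (K := C + κ / 2) (Real.exp_nonneg _) hκ2.le (by positivity)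
    (fun s hs => by
      refine le_trans ?_ (le_expect_cover hC hC' hq hq' (hA s))
      rw [mul_comm]
      exact mul_le_mul_of_nonneg_left hs (Real.exp_nonneg _))
    (fun s => expect_cover_le hC hC' hq hq' (hA s))
    (fun y => expect_confuse_le hp₁ hp₁' hq hq' fun u h => h)
    (fun s u h => h.2.2.2)
    (fun s u h => h.2.1)
  have hS : expect (bernWord p₂ n) (fun s => ind (¬(1 / 2 ≤ expect (bernWord C n) fun x =>
      ind (Covers p₁ C q δ (κ / 2) (κ / 2) s (s + x))))) ≤
      2 * expect (bernWord p₂ n) fun s => expect (bernWord C n) fun x =>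
        ind (¬Covers p₁ C q δ (κ / 2) (κ / 2) s (s + x)) := by
    have h := P2.markov (F := fun s => expect (bernWord C n) fun x =>
        ind (¬Covers p₁ C q δ (κ / 2) (κ / 2) s (s + x)))
      (fun s => PC.expect_nonneg fun x => ind_nonneg _) (by norm_num : (0 : ℝ) < 1 / 2)
    refine (P2.expect_mono fun s => ind_mono fun hs => ?_).trans (h.trans_eq (by ring))
    simp only [ind_not]
    rw [expect_sub, PC.expect_const]
    linarith
  have h1 := exp_uncovered_le (I := Real.binEntropy q - Real.binEntropy C) (δ := δ) n
  have h2 := confusion_le (I := Real.binEntropy q - Real.binEntropy C) (sub_nonneg.2 hCq) hδ0.le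
    (Real.binEntropy (bconv q p₁) - Real.binEntropy p₁) (by rw [hδ]; ring) n
  exact ⟨c, by linarith, by linarith⟩

end RandomCoding

/-! ### From codes of every block length to the minimum distortion -/

instance finite_code (n : ℕ) : Finite (Code n) :=
  Finite.of_injective (fun c : Code n => (c.enc, c.dec)) fun c c' h => by
    cases c; cases c'; simpa using h

section MinDistortion

variable {p₁ p₂ C : ℝ}

lemma Code.expectedDistortion_nonneg (hp₁ : 0 ≤ p₁) (hp₁' : p₁ ≤ 1) (hp₂ : 0 ≤ p₂)
    (hp₂' : p₂ ≤ 1) {n : ℕ} (c : Code n) : 0 ≤ c.expectedDistortion p₁ p₂ := by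
  rw [Code.expectedDistortion_eq]
  exact (isPmf_bernWord hp₂ hp₂' n).expect_nonneg fun s =>
    (isPmf_bernWord hp₁ hp₁' n).expect_nonneg fun t =>
      div_nonneg (Finset.sum_nonneg fun i _ => distortion_nonneg _ _) n.cast_nonneg

lemma Code.expectedDistortion_le_one (hp₁ : 0 ≤ p₁) (hp₁' : p₁ ≤ 1) (hp₂ : 0 ≤ p₂)
    (hp₂' : p₂ ≤ 1) {n : ℕ} (c : Code n) : c.expectedDistortion p₁ p₂ ≤ 1 := by
  rw [Code.expectedDistortion_eq]
  exact (isPmf_bernWord hp₂ hp₂' n).expect_le fun s =>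
    (isPmf_bernWord hp₁ hp₁' n).expect_le fun t => sum_div_le_one fun i => distortion_le_one _ _

/-- Choosing for each block length a code that minimizes the larger of the excess cost and the
distortion turns codes for every slack `κ` into a single sequence of codes. -/
lemma achievable_zero_of_eventually (hp₁ : 0 ≤ p₁) (hp₁' : p₁ ≤ 1) (hp₂ : 0 ≤ p₂)
    (hp₂' : p₂ ≤ 1)
    (h : ∀ κ > 0, ∀ᶠ n in atTop, ∃ c : Code n,
      c.expectedCost p₂ ≤ C + κ ∧ c.expectedDistortion p₁ p₂ ≤ κ) :
    Achievable p₁ p₂ C 0 := by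
  have hne : ∀ n, Nonempty (Code n) := fun n => ⟨⟨id, id⟩⟩
  have hmin : ∀ n, ∃ c : Code n, ∀ c' : Code n,
      max (c.expectedCost p₂ - C) (c.expectedDistortion p₁ p₂) ≤
      max (c'.expectedCost p₂ - C) (c'.expectedDistortion p₁ p₂) :=
    fun n => have := hne n; Finite.exists_min _
  choose c hc using hmin
  have hd0 := fun n => (c n).expectedDistortion_nonneg hp₁ hp₁' hp₂ hp₂'
  have hε : Tendsto (fun n => max ((c n).expectedCost p₂ - C) ((c n).expectedDistortion p₁ p₂))
      atTop (𝓝 0) := by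
    rw [tendsto_order]
    refine ⟨fun a ha => Eventually.of_forall fun n =>
      ha.trans_le ((hd0 n).trans (le_max_right _ _)), fun a ha => ?_⟩
    filter_upwards [h (a / 2) (by positivity)] with n ⟨c', h1, h2⟩
    refine ((hc n c').trans (max_le ?_ h2)).trans_lt (half_lt_self ha)
    linarith
  refine ⟨c, _, hε, fun n _ => ?_, ?_⟩
  · linarith [le_max_left ((c n).expectedCost p₂ - C) ((c n).expectedDistortion p₁ p₂)]
  · exact (squeeze_zero hd0 (fun n => le_max_right _ _) hε).limsup_eq.le

lemma minDistortion_eq_zero (hp₁ : 0 ≤ p₁) (hp₁' : p₁ ≤ 1) (hp₂ : 0 ≤ p₂) (hp₂' : p₂ ≤ 1)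
    (h : Achievable p₁ p₂ C 0) : minDistortion p₁ p₂ C = 0 := by
  refine le_antisymm (sInf_le ⟨0, h, rfl⟩) (le_sInf ?_)
  rintro _ ⟨D, ⟨c, ε, -, -, hD⟩, rfl⟩
  refine EReal.coe_nonneg.2 (le_trans ?_ hD)
  refine le_limsup_of_frequently_le (Frequently.of_forall fun n =>
    (c n).expectedDistortion_nonneg hp₁ hp₁' hp₂ hp₂') ?_
  exact isBoundedUnder_of ⟨1, fun n => (c n).expectedDistortion_le_one hp₁ hp₁' hp₂ hp₂'⟩

lemma minDistortion_eq_zero_of_codes (hp₁ : 0 ≤ p₁) (hp₁' : p₁ ≤ 1) (hp₂ : 0 ≤ p₂)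
    (hp₂' : p₂ ≤ 1) (h : ∀ n, 1 ≤ n → ∃ c : Code n,
      c.expectedCost p₂ ≤ C ∧ c.expectedDistortion p₁ p₂ = 0) :
    minDistortion p₁ p₂ C = 0 := by
  refine minDistortion_eq_zero hp₁ hp₁' hp₂ hp₂'
    (achievable_zero_of_eventually hp₁ hp₁' hp₂ hp₂' fun κ hκ => ?_)
  filter_upwards [eventually_ge_atTop 1] with n hn
  obtain ⟨c, h1, h2⟩ := h n hn
  exact ⟨c, by linarith, by linarith⟩

/-- A helper that can afford `X = S₂` cancels the interference. -/
lemma minDistortion_eq_zero_of_le (hp₁ : 0 ≤ p₁) (hp₁' : p₁ ≤ 1) (hp₂ : 0 ≤ p₂) (hp₂' : p₂ ≤ 1)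
    (hC : p₂ ≤ C) : minDistortion p₁ p₂ C = 0 := by
  refine minDistortion_eq_zero_of_codes hp₁ hp₁' hp₂ hp₂' fun n hn => ⟨⟨id, id⟩, ?_, ?_⟩
  · have hn' : (n : ℝ) ≠ 0 := by positivity
    have h1 : expect (bern p₂) cost = p₂ := by simp [expect, cost]
    simp only [Code.expectedCost, id, div_eq_inv_mul]
    rw [expect_const_mul, expect_finset_sum]
    have h2 : ∀ i : Fin n, expect (bernWord p₂ n) (fun s => cost (s i)) = p₂ := fun i =>
      ((isPmf_bern hp₂ hp₂').expect_iid_apply i cost).trans h1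
    simp [h2, hn', hC]
  · have h : ∀ s t : Word n, s + t + s = t := fun s t => by
      rw [add_comm, word_add_cancel_left]
    simp [Code.expectedDistortion, Code.output, h, distortion, expect]

/-- If `S₁` vanishes there is nothing to estimate. -/
lemma minDistortion_zero_left (hp₂ : 0 ≤ p₂) (hp₂' : p₂ ≤ 1) (hC : 0 ≤ C) :
    minDistortion 0 p₂ C = 0 := by
  refine minDistortion_eq_zero_of_codes le_rfl zero_le_one hp₂ hp₂' fun n _ =>
    ⟨⟨fun _ => 0, fun _ => 0⟩, ?_, ?_⟩
  · simp [Code.expectedCost, cost, expect, hC]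
  · refine Finset.sum_eq_zero fun ω _ => ?_
    by_cases h : ω.1 = 0
    · simp [h, distortion]
    · obtain ⟨i, hi⟩ := Function.ne_iff.1 h
      have hi' : ω.1 i = 1 := by
        have : ∀ b : Bit, b ≠ 0 → b = 1 := by decide
        exact this _ hi
      have h0 : bernWord 0 n ω.1 = 0 :=
        Finset.prod_eq_zero (Finset.mem_univ i) (by rw [hi', bern_one_bit])
      simp [h0]

end MinDistortion

/-! ### The entropy condition in terms of binary entropies -/

section Entropy

variable {p₁ p₂ C : ℝ}

lemma sum_triple (f : Bit × Bit × Bit → ℝ) : ∑ ω, f ω =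
    f (0, 0, 0) + f (0, 0, 1) + f (0, 1, 0) + f (0, 1, 1) +
    f (1, 0, 0) + f (1, 0, 1) + f (1, 1, 0) + f (1, 1, 1) := by
  simp only [Fintype.sum_prod_type, sum_bit]
  ring

lemma law_pair (a b : Bit) :
    law (tripleLaw p₁ p₂ C) (fun ω => (ω.1 + ω.2.2, ω.1 + ω.2.1 + ω.2.2)) (a, b) =
      bern (bconv p₂ C) a * bern p₁ (b + a) := by
  have h11 : (1 : Bit) + 1 = 0 := rfl
  have h10 : (1 : Bit) ≠ 0 := by decide
  have hbit : ∀ b : Bit, b = 0 ∨ b = 1 := by decide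
  simp only [law, Finset.sum_filter, sum_triple, tripleLaw, Prod.mk.injEq]
  rcases hbit a with rfl | rfl <;> rcases hbit b with rfl | rfl <;>
    simp [h11, h10, bconv] <;> ring

lemma law_output (b : Bit) :
    law (tripleLaw p₁ p₂ C) (fun ω => ω.1 + ω.2.1 + ω.2.2) b =
      bern (bconv (bconv p₂ C) p₁) b := by
  have h11 : (1 : Bit) + 1 = 0 := rfl
  have h10 : (1 : Bit) ≠ 0 := by decide
  have hbit : ∀ b : Bit, b = 0 ∨ b = 1 := by decide
  simp only [law, Finset.sum_filter, sum_triple, tripleLaw]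
  rcases hbit b with rfl | rfl <;>
    simp [h11, h10, bconv] <;> ring

lemma entropyXS₂GivenY_eq (hp₁ : 0 < p₁) (hp₁' : p₁ < 1) (hq : 0 < bconv p₂ C)
    (hq' : bconv p₂ C < 1) :
    entropyXS₂GivenY p₁ p₂ C = Real.binEntropy (bconv p₂ C) + Real.binEntropy p₁ -
      Real.binEntropy (bconv (bconv p₂ C) p₁) := by
  simp only [entropyXS₂GivenY, condEntropy, law_pair, law_output]
  generalize bconv p₂ C = q at hq hq'
  have hl : ∀ a b : Bit, Real.log (bern q a * bern p₁ (b + a) / bern (bconv q p₁) b) =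
      Real.log (bern q a) + Real.log (bern p₁ (b + a)) - Real.log (bern (bconv q p₁) b) := by
    intro a b
    have ha := bern_pos hq hq' a
    have hb := bern_pos hp₁ hp₁' (b + a)
    have hc := bern_pos (bconv_pos hq hq' hp₁.le hp₁') (bconv_lt_one hq hq' hp₁.le hp₁') b
    rw [Real.log_div (mul_pos ha hb).ne' hc.ne', Real.log_mul ha.ne' hb.ne']
  have h11 : (1 : Bit) + 1 = 0 := rfl
  have hr : 1 - bconv q p₁ = (1 - q) * (1 - p₁) + q * p₁ := by unfold bconv; ring
  simp only [hl, sum_bit, add_zero, zero_add, h11, bern_zero_bit, bern_one_bit, Real.binEntropy,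
    Real.log_inv]
  generalize Real.log (1 - bconv q p₁) = l0
  generalize Real.log (bconv q p₁) = l1
  rw [hr, bconv]
  ring

lemma law_nonneg {Ω α : Type*} [Fintype Ω] [DecidableEq α] {P : Ω → ℝ} (hP : ∀ ω, 0 ≤ P ω)
    (A : Ω → α) (a : α) : 0 ≤ law P A a :=
  Finset.sum_nonneg fun ω _ => hP ω

lemma condEntropy_nonneg {Ω α β : Type*} [Fintype Ω] [Fintype α] [Fintype β] [DecidableEq α]
    [DecidableEq β] {P : Ω → ℝ} (hP : ∀ ω, 0 ≤ P ω) (A : Ω → α) (B : Ω → β) :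
    0 ≤ condEntropy P A B := by
  refine neg_nonneg.2 (Finset.sum_nonpos fun b _ => Finset.sum_nonpos fun a _ => ?_)
  have h1 := law_nonneg hP (fun ω => (A ω, B ω)) (a, b)
  have h2 : law P (fun ω => (A ω, B ω)) (a, b) ≤ law P B b := by
    refine Finset.sum_le_sum_of_subset_of_nonneg (fun ω hω => ?_) fun ω _ _ => hP ω
    simp only [Finset.mem_filter, Prod.mk.injEq] at hω ⊢
    exact ⟨hω.1, hω.2.2⟩
  exact mul_nonpos_of_nonneg_of_nonpos h1
    (Real.log_nonpos (div_nonneg h1 (h1.trans h2)) (div_le_one_of_le₀ h2 (h1.trans h2)))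

end Entropy

/-! ### The two coding regimes -/

section Regimes

variable {p₁ p₂ C : ℝ}

/-- Codewords of law `Bern(p₂ * C)`, the law of `X ⊕ S₂`. -/
lemma minDistortion_eq_zero_of_entropy (hp₁ : 0 < p₁) (hp₁' : p₁ ≤ 1 / 2) (hp₂' : p₂ ≤ 1 / 2)
    (hC : 0 < C) (hCp : C < p₂)
    (h : entropyXS₂GivenY p₁ p₂ C < Real.binEntropy C) : minDistortion p₁ p₂ C = 0 := by
  have hp₂ : 0 < p₂ := hC.trans hCp
  have hq : 0 < bconv p₂ C := bconv_pos hp₂ (by linarith) hC.le (by linarith)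
  have hq' : bconv p₂ C < 1 := bconv_lt_one hp₂ (by linarith) hC.le (by linarith)
  rw [entropyXS₂GivenY_eq hp₁ (by linarith) hq hq'] at h
  have hCq : Real.binEntropy C ≤ Real.binEntropy (bconv p₂ C) := by
    have h1 : C ≤ bconv p₂ C := by unfold bconv; nlinarith
    have h2 : bconv p₂ C ≤ 2⁻¹ := by unfold bconv; nlinarith
    exact Real.binEntropy_strictMonoOn.monotoneOn ⟨hC.le, h1.trans h2⟩ ⟨hq.le, h2⟩ h1
  refine minDistortion_eq_zero hp₁.le (by linarith) hp₂.le (by linarith)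
    (achievable_zero_of_eventually hp₁.le (by linarith) hp₂.le (by linarith) fun κ hκ =>
      exists_code_of_exponents hp₁ (by linarith) hp₂.le (by linarith) hC (by linarith) hq hq' hCq
        (by linarith) (fun δ hδ => ?_) (fun δ hδ => ?_) hκ)
  · refine (tendsto_not_typical hq hq' hδ).congr fun n => ?_
    exact (expect_bernWord_add p₂ C fun u : Word n => ind (¬Typical (bconv p₂ C) δ u)).symm
  · refine (tendsto_not_typical (bconv_pos hq hq' hp₁.le (by linarith))
      (bconv_lt_one hq hq' hp₁.le (by linarith)) hδ).congr fun n => ?_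
    rw [expect_bernWord_add p₂ C fun u : Word n => expect (bernWord p₁ n) fun t =>
      ind (¬Typical (bconv (bconv p₂ C) p₁) δ (u + t)),
      expect_bernWord_add (bconv p₂ C) p₁ fun y : Word n =>
        ind (¬Typical (bconv (bconv p₂ C) p₁) δ y)]

/-- Uniformly distributed codewords: every word is typical for them, whatever `p₂` is. -/
lemma minDistortion_eq_zero_of_uniform (hp₁ : 0 < p₁) (hp₂ : 0 ≤ p₂) (hp₂' : p₂ ≤ 1)
    (hC : p₁ < C) (hC' : C < 1 / 2) : minDistortion p₁ p₂ C = 0 := by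
  have hr : bconv (1 / 2) p₁ = 1 / 2 := by unfold bconv; ring
  have hlt : Real.binEntropy p₁ < Real.binEntropy C :=
    Real.binEntropy_strictMonoOn ⟨hp₁.le, by linarith⟩ ⟨by linarith, by linarith⟩ hC
  have hle : Real.binEntropy C ≤ Real.binEntropy (1 / 2) := by
    rw [one_div, Real.binEntropy_two_inv]; exact Real.binEntropy_le_log_two
  refine minDistortion_eq_zero hp₁.le (by linarith) hp₂ hp₂'
    (achievable_zero_of_eventually hp₁.le (by linarith) hp₂ hp₂' fun κ hκ =>
      exists_code_of_exponents (q := 1 / 2) hp₁ (by linarith) hp₂ hp₂' (by linarith) (by linarith)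
        (by norm_num) (by norm_num) hle (by rw [hr]; linarith) (fun δ hδ => ?_) (fun δ hδ => ?_) hκ)
  · simp [expect, ind_of_false (not_not.2 (typical_half (le_of_lt hδ) _)), -one_div]
  · simp [hr, expect, ind_of_false (not_not.2 (typical_half (le_of_lt hδ) _)), -one_div]

end Regimes

end HelperEstimation

end

theorem proposition1 (p₁ p₂ : ℝ) (hp₁ : 0 ≤ p₁) (hp₁' : p₁ ≤ 1 / 2)
    (hp₂ : 0 ≤ p₂) (hp₂' : p₂ ≤ 1 / 2) :
    (∀ C : ℝ, 0 ≤ C → C ≤ 1 →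
      HelperEstimation.entropyXS₂GivenY p₁ p₂ C < Real.binEntropy C →
      HelperEstimation.minDistortion p₁ p₂ C = 0) ∧
    (∀ C : ℝ, p₁ < C → HelperEstimation.minDistortion p₁ p₂ C = 0) := by
  constructor
  · intro C hC0 hC1 h
    rcases le_or_gt p₂ C with hC | hC
    · exact HelperEstimation.minDistortion_eq_zero_of_le hp₁ (by linarith) hp₂ (by linarith) hC
    rcases hp₁.eq_or_lt with rfl | hp₁0
    · exact HelperEstimation.minDistortion_zero_left hp₂ (by linarith) hC0
    rcases hC0.eq_or_lt with rfl | hC0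
    · -- A helper without budget cannot satisfy the hypothesis: the binary entropy of `0` is `0`.
      have hnn : 0 ≤ HelperEstimation.entropyXS₂GivenY p₁ p₂ 0 :=
        HelperEstimation.condEntropy_nonneg (fun ω => mul_nonneg (mul_nonneg
          ((HelperEstimation.isPmf_bern le_rfl zero_le_one).nonneg _)
          ((HelperEstimation.isPmf_bern hp₁ (by linarith)).nonneg _))
        ((HelperEstimation.isPmf_bern hp₂ (by linarith)).nonneg _)) _ _
      rw [Real.binEntropy_zero] at h
      exact absurd h hnn.not_gt
    · exact HelperEstimation.minDistortion_eq_zero_of_entropy hp₁0 hp₁' hp₂' hC0 hC h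
  · intro C hC
    rcases le_or_gt p₂ C with hC' | hC'
    · exact HelperEstimation.minDistortion_eq_zero_of_le hp₁ (by linarith) hp₂ (by linarith) hC'
    rcases hp₁.eq_or_lt with rfl | hp₁0
    · exact HelperEstimation.minDistortion_zero_left hp₂ (by linarith) hC.le
    · exact HelperEstimation.minDistortion_eq_zero_of_uniform hp₁0 hp₂ (by linarith) hC
        (hC'.trans_le hp₂')
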